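/- A similarity of $\mathbb{R}^3$ is a map $f(\mathbf{x}) = \lambda Q\mathbf{x} + \mathbf{b}$ with $0 \neq \lambda \in \mathbb{R}$, $Q \in SO(3)$ and $\mathbf{b} \in \mathbb{R}^3$; the same formula extends it to $\mathbb{C}^3$. Let $\mathbb{K}$ be $\mathbb{R}$ or $\mathbb{C}$. An algebraic space curve in $\mathbb{K}^3$ is a set $\mathcal{C} \subseteq \mathbb{K}^3$ that is the common zero set of a set of polynomials in $\mathbb{K}[x,y,z]$ and has dimension one, i.e. the quotient of $\mathbb{K}[x,y,z]$ by the ideal of all polynomials vanishing on $\mathcal{C}$ has Krull dimension one. Theorem. Let $\mathcal{C} \subset \mathbb{K}^3$ be an algebraic space curve that is not a union of lines of $\mathbb{K}^3$ (so possibly complex lines, if $\mathbb{K} = \mathbb{C}$) all passing through a common point. If a similarity $f$ leaves $\mathcal{C}$ invariant, i.e. $f(\mathcal{C}) = \mathcal{C}$, then $f$ is an isometry of $\mathbb{R}^3$, i.e. it preserves Euclidean distances. -/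

import Mathlib

/-- A similarity of Euclidean 3-space, `x ↦ ratio • rot x + trans`, with a nonzero real (signed)
ratio, a special orthogonal matrix and a translation vector. -/
structure Similarity where
  ratio : ℝ
  ratio_ne_zero : ratio ≠ 0
  rot : Matrix.specialOrthogonalGroup (Fin 3) ℝ
  trans : EuclideanSpace ℝ (Fin 3)

/-- The action of a similarity on the `𝕜`-points of 3-space. For `𝕜 = ℝ` this is the similarity
itself, for `𝕜 = ℂ` it is its extension to complex space by the same formula. -/
noncomputable def Similarity.map (f : Similarity) (𝕜 : Type*) [RCLike 𝕜]
    (x : EuclideanSpace 𝕜 (Fin 3)) : EuclideanSpace 𝕜 (Fin 3) :=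
  WithLp.toLp 2 fun i =>
    (f.ratio : 𝕜) * (∑ j, (((f.rot : Matrix (Fin 3) (Fin 3) ℝ) i j : ℝ) : 𝕜) * x j)
      + ((f.trans i : ℝ) : 𝕜)

/-- An algebraic space curve: the common zero set in `𝕜³` of a set of polynomials, of dimension
one, i.e. the ring of polynomial functions on it has Krull dimension one. -/
def IsAlgebraicSpaceCurve {𝕜 : Type*} [RCLike 𝕜] (C : Set (EuclideanSpace 𝕜 (Fin 3))) : Prop :=
  (∃ S : Set (MvPolynomial (Fin 3) 𝕜), C = {x | ∀ p ∈ S, MvPolynomial.eval (x ·) p = 0}) ∧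
  ringKrullDim (MvPolynomial (Fin 3) 𝕜 ⧸
    MvPolynomial.vanishingIdeal 𝕜 ((fun (x : EuclideanSpace 𝕜 (Fin 3)) i => x i) '' C)) = 1

/-- `C` is a union of lines of `𝕜³` that all pass through a common point. -/
def IsUnionOfConcurrentLines {𝕜 : Type*} [RCLike 𝕜] (C : Set (EuclideanSpace 𝕜 (Fin 3))) : Prop :=
  ∃ (c : EuclideanSpace 𝕜 (Fin 3)) (lines : Set (AffineSubspace 𝕜 (EuclideanSpace 𝕜 (Fin 3)))),
    (∀ L ∈ lines, c ∈ L ∧ Module.finrank 𝕜 L.direction = 1) ∧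
    C = ⋃ L ∈ lines, (L : Set (EuclideanSpace 𝕜 (Fin 3)))

open Filter Topology

/-! If the ratio is not `±1`, then `f` has a fixed point `c`, and `f` or its inverse is `x ↦ c + μ U
(x - c)` with `U` a linear isometry and `|μ| > 1`. Let `p` vanish on `C`, with homogeneous
components `p_d` about `c`. Along the orbit of `c + v ∈ C`, `∑ μ ^ (n d) p_d (U ^ n v) = 0`. Growth
forces the top `p_d (U ^ n v)` to tend to `0`, and recurrence of the bounded orbit makes it vanish;
descending in `d`, every `p_d v = 0` (`Isometry.eq_zero_of_sum_pow_mul_eq_zero`). So `p` vanishes on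
the line through `c` and `c + v`: `C` is a cone, hence a union of lines through `c`. -/

theorem Isometry.iterate {X : Type*} [PseudoEMetricSpace X] {T : X → X} (hT : Isometry T) (n : ℕ) :
    Isometry T^[n] :=
  n.rec isometry_id fun _ ih => ih.comp hT

/-- A point with precompact orbit under an isometry is recurrent. -/
theorem Isometry.mapClusterPt_iterate {X : Type*} [MetricSpace X] {T : X → X} (hT : Isometry T)
    {K : Set X} (hK : IsCompact K) {y : X} (hy : ∀ n, T^[n] y ∈ K) :
    MapClusterPt y atTop fun n => T^[n] y := by
  obtain ⟨a, -, φ, hφ, ha⟩ := hK.tendsto_subseq hy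
  rw [mapClusterPt_iff_frequently]
  intro s hs
  obtain ⟨ε, hε, hs⟩ := Metric.mem_nhds_iff.1 hs
  obtain ⟨M, hM⟩ := Metric.cauchySeq_iff.1 ha.cauchySeq ε hε
  rw [frequently_atTop]
  intro N
  -- This index makes the gap between the two times at least `N` and stays past the Cauchy threshold
  -- `M`; cancelling `T^[φ M]` turns closeness of the two points into a return to `y`.
  have hle : φ M + N + M ≤ φ (φ M + N + M) := hφ.id_le _
  refine ⟨φ (φ M + N + M) - φ M, by omega, hs ?_⟩
  have hdist := hM (φ M + N + M) (by omega) M le_rfl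
  have hsplit : T^[φ (φ M + N + M)] y = T^[φ M] (T^[φ (φ M + N + M) - φ M] y) := by
    rw [← Function.iterate_add_apply]
    congr 2
    omega
  simp only [Function.comp_apply] at hdist
  rw [hsplit, (hT.iterate (φ M)).dist_eq] at hdist
  exact hdist

theorem eq_of_mapClusterPt_of_tendsto {α X : Type*} [TopologicalSpace X] [T2Space X] {l : Filter α}
    {u : α → X} {x y : X} (hx : MapClusterPt x l u) (hy : Tendsto u l (𝓝 y)) : x = y :=
  haveI : NeBot (𝓝 x ⊓ 𝓝 y) := NeBot.mono hx (inf_le_inf_left _ hy)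
  eq_of_nhds_neBot this

/-- Along a precompact orbit of an isometry, functions weighted by distinct powers of `μ ^ n`,
`1 < ‖μ‖`, are independent. -/
theorem Isometry.eq_zero_of_sum_pow_mul_eq_zero {X 𝕜 : Type*} [MetricSpace X] [NormedField 𝕜]
    {T : X → X} (hT : Isometry T) {K : Set X} (hK : IsCompact K) {y : X} (hy : ∀ n, T^[n] y ∈ K)
    {μ : 𝕜} (hμ : 1 < ‖μ‖) (g : ℕ → X → 𝕜) (hg : ∀ d, Continuous (g d)) (D : ℕ)
    (hsum : ∀ n, ∑ d ∈ Finset.range D, (μ ^ n) ^ d * g d (T^[n] y) = 0) :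
    ∀ d < D, ∀ n, g d (T^[n] y) = 0 := by
  have hμ0 : μ ≠ 0 := norm_pos_iff.1 (zero_lt_one.trans hμ)
  induction D with
  | zero => simp
  | succ D ih =>
    -- Divide the relation by `(μ ^ n) ^ D`: each lower term becomes a bounded factor times a
    -- geometric sequence of ratio below `1`.
    have htop : Tendsto (fun n => g D (T^[n] y)) atTop (𝓝 0) := by
      have hterm : ∀ d ∈ Finset.range D, Tendsto
          (fun n => ((μ ^ (D - d))⁻¹) ^ n * g d (T^[n] y)) atTop (𝓝 0) := by
        intro d hd
        obtain ⟨B, hB⟩ := hK.exists_bound_of_continuousOn (hg d).continuousOn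
        refine Tendsto.zero_mul_isBoundedUnder_le
          (tendsto_pow_atTop_nhds_zero_of_norm_lt_one ?_)
          (isBoundedUnder_of ⟨B, fun n => hB _ (hy n)⟩)
        rw [norm_inv, norm_pow]
        have hd' : D - d ≠ 0 := by have := Finset.mem_range.1 hd; omega
        exact inv_lt_one_of_one_lt₀ (one_lt_pow₀ hμ hd')
      have hlim := (tendsto_finsetSum (Finset.range D) hterm).neg
      simp only [Finset.sum_const_zero, neg_zero] at hlim
      refine hlim.congr fun n => ?_
      have h := hsum n
      rw [Finset.sum_range_succ, add_comm, ← eq_neg_iff_add_eq_zero] at h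
      have hpow : (μ ^ n) ^ D ≠ 0 := pow_ne_zero _ (pow_ne_zero _ hμ0)
      rw [← mul_right_inj' hpow, h, mul_neg, Finset.mul_sum]
      congr 1
      refine Finset.sum_congr rfl fun d hd => ?_
      have hsplit : (μ ^ n) ^ D = (μ ^ n) ^ d * (μ ^ (D - d)) ^ n := by
        rw [← pow_mul, ← pow_mul, ← pow_mul, ← pow_add, mul_comm (D - d), ← mul_add,
          Nat.add_sub_cancel' (Finset.mem_range.1 hd).le]
      have hne : (μ ^ (D - d)) ^ n ≠ 0 := pow_ne_zero _ (pow_ne_zero _ hμ0)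
      rw [hsplit, inv_pow]
      field_simp
    have hD : ∀ n, g D (T^[n] y) = 0 := by
      intro m
      -- By recurrence, the value at `T^[m] y` is a cluster value of a sequence tending to `0`.
      have hrec := hT.mapClusterPt_iterate hK (y := T^[m] y)
        fun n => by rw [← Function.iterate_add_apply]; exact hy _
      refine eq_of_mapClusterPt_of_tendsto
        (hrec.continuousAt_comp (f := g D) (hg D).continuousAt) ?_
      refine (htop.comp (tendsto_add_atTop_nat m)).congr fun n => ?_
      simp [Function.iterate_add_apply]
    intro d hd n
    rcases Nat.lt_succ_iff_lt_or_eq.1 hd with hd | rfl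
    · exact ih (fun n => by simpa [Finset.sum_range_succ, hD] using hsum n) d hd n
    · exact hD n

theorem MvPolynomial.IsHomogeneous.eval_smul {σ R : Type*} [Fintype σ] [CommSemiring R]
    {p : MvPolynomial σ R} {d : ℕ} (hp : p.IsHomogeneous d) (t : R) (x : σ → R) :
    eval (t • x) p = t ^ d * eval x p := by
  rw [eval_eq', eval_eq', Finset.mul_sum]
  refine Finset.sum_congr rfl fun m hm => ?_
  have hdeg : ∑ i, m i = d := by
    rw [← hp (mem_support_iff.1 hm), Finsupp.weight_apply, Finsupp.sum_fintype _ _ (by simp)]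
    simp
  simp only [Pi.smul_apply, smul_eq_mul, mul_pow, Finset.prod_mul_distrib,
    Finset.prod_pow_eq_pow_sum, hdeg]
  ring

theorem MvPolynomial.eval_smul_eq_sum {σ R : Type*} [Fintype σ] [CommSemiring R]
    (p : MvPolynomial σ R) (t : R) (x : σ → R) :
    eval (t • x) p =
      ∑ d ∈ Finset.range (p.totalDegree + 1), t ^ d * eval x (homogeneousComponent d p) := by
  conv_lhs => rw [← sum_homogeneousComponent p, map_sum]
  exact Finset.sum_congr rfl fun d _ => (homogeneousComponent_isHomogeneous d p).eval_smul t x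

/-- An algebraic set which is invariant under an expanding similarity with centre `c` is a cone
with vertex `c`. -/
theorem add_smul_mem_of_forall_mem {𝕜 ι : Type*} [RCLike 𝕜] [Fintype ι]
    {C : Set (EuclideanSpace 𝕜 ι)} {S : Set (MvPolynomial ι 𝕜)}
    (hC : C = {x | ∀ p ∈ S, MvPolynomial.eval (x ·) p = 0})
    (U : EuclideanSpace 𝕜 ι ≃ₗᵢ[𝕜] EuclideanSpace 𝕜 ι) {μ : 𝕜} (hμ : 1 < ‖μ‖)
    (c : EuclideanSpace 𝕜 ι) (hinv : ∀ x ∈ C, c + μ • U (x - c) ∈ C)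
    {x : EuclideanSpace 𝕜 ι} (hx : x ∈ C) (t : 𝕜) : c + t • (x - c) ∈ C := by
  have horbit : ∀ n : ℕ, c + μ ^ n • U^[n] (x - c) ∈ C := by
    intro n
    induction n with
    | zero => simpa using hx
    | succ n ih =>
      have h := hinv _ ih
      rwa [add_sub_cancel_left, map_smul, smul_smul, ← pow_succ',
        ← Function.iterate_succ_apply' U] at h
  rw [hC]
  intro p hp
  set q : MvPolynomial ι 𝕜 :=
    MvPolynomial.aeval (fun i => MvPolynomial.C (c i) + MvPolynomial.X i) p with hq
  have hqeval : ∀ v : EuclideanSpace 𝕜 ι, ∀ s : 𝕜,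
      MvPolynomial.eval (fun i => (c + s • v) i) p = MvPolynomial.eval (s • fun i => v i) q := by
    intro v s
    rw [hq, ← MvPolynomial.coe_aeval_eq_eval, ← MvPolynomial.coe_aeval_eq_eval]
    simp only [RingHom.coe_coe]
    rw [← AlgHom.comp_apply, MvPolynomial.comp_aeval]
    simp
  have hbound : ∀ n, U^[n] (x - c) ∈ Metric.closedBall (0 : EuclideanSpace 𝕜 ι) ‖x - c‖ := by
    intro n
    rw [mem_closedBall_zero_iff]
    induction n with
    | zero => simp
    | succ n ih => rwa [Function.iterate_succ_apply', U.norm_map]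
  have hzero := U.isometry.eq_zero_of_sum_pow_mul_eq_zero (isCompact_closedBall _ _) hbound hμ
    (fun d v => MvPolynomial.eval (fun i => v i) (MvPolynomial.homogeneousComponent d q))
    (fun d => (MvPolynomial.continuous_eval _).comp (by fun_prop)) (q.totalDegree + 1) fun n => by
      rw [← MvPolynomial.eval_smul_eq_sum, ← hqeval]
      have h := horbit n
      rw [hC] at h
      exact h p hp
  rw [hqeval, MvPolynomial.eval_smul_eq_sum]
  exact Finset.sum_eq_zero fun d hd =>
    mul_eq_zero_of_right _ (hzero d (Finset.mem_range.1 hd) 0)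

/-- The vanishing ideal of a point is maximal, so the quotient is a field, of dimension zero. -/
theorem IsAlgebraicSpaceCurve.ne_singleton {𝕜 : Type*} [RCLike 𝕜]
    {C : Set (EuclideanSpace 𝕜 (Fin 3))} (hC : IsAlgebraicSpaceCurve C)
    (c : EuclideanSpace 𝕜 (Fin 3)) : C ≠ {c} := by
  rintro rfl
  have h := hC.2
  rw [Set.image_singleton, ringKrullDim_eq_zero_of_isField
    ((Ideal.Quotient.maximal_ideal_iff_isField_quotient _).1 inferInstance)] at h
  exact zero_ne_one h

/-- A cone which is not reduced to its vertex is a union of lines through the vertex. -/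
theorem isUnionOfConcurrentLines_of_add_smul_mem {𝕜 : Type*} [RCLike 𝕜]
    {C : Set (EuclideanSpace 𝕜 (Fin 3))} {c : EuclideanSpace 𝕜 (Fin 3)} (hne : C ≠ {c})
    (hcone : ∀ x ∈ C, ∀ t : 𝕜, c + t • (x - c) ∈ C) : IsUnionOfConcurrentLines C := by
  have hline : ∀ x ∈ C, x ≠ c → ∃ L : AffineSubspace 𝕜 (EuclideanSpace 𝕜 (Fin 3)),
      (c ∈ L ∧ Module.finrank 𝕜 L.direction = 1 ∧ (L : Set _) ⊆ C) ∧ x ∈ L := by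
    intro x hx hxc
    refine ⟨AffineSubspace.mk' c (Submodule.span 𝕜 {x - c}),
      ⟨AffineSubspace.self_mem_mk' _ _, ?_, ?_⟩, ?_⟩
    · rw [AffineSubspace.direction_mk']
      exact finrank_span_singleton (sub_ne_zero.2 hxc)
    · intro z hz
      obtain ⟨t, ht⟩ := Submodule.mem_span_singleton.1 (AffineSubspace.mem_mk'.1 hz)
      have h := hcone x hx t
      rwa [ht, vsub_eq_sub, add_sub_cancel] at h
    · exact AffineSubspace.mem_mk'.2 (Submodule.mem_span_singleton_self _)
  refine ⟨c, {L | c ∈ L ∧ Module.finrank 𝕜 L.direction = 1 ∧ (L : Set _) ⊆ C},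
    fun L hL => ⟨hL.1, hL.2.1⟩, Set.Subset.antisymm (fun x hx => ?_)
    (Set.iUnion₂_subset fun L hL => hL.2.2)⟩
  rw [Set.mem_iUnion₂]
  by_cases hxc : x = c
  -- The vertex spans no line with itself; it is covered by the line of any other point of `C`.
  · obtain ⟨y, hy, hyc⟩ : ∃ y ∈ C, y ≠ c := by
      by_contra! h
      exact hne (Set.eq_singleton_iff_unique_mem.2 ⟨hxc ▸ hx, h⟩)
    obtain ⟨L, hL, -⟩ := hline y hy hyc
    exact ⟨L, hL, hxc ▸ hL.1⟩
  · obtain ⟨L, hL, hxL⟩ := hline x hx hxc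
    exact ⟨L, hL, hxL⟩

theorem Similarity.exists_map_eq (f : Similarity) (𝕜 : Type*) [RCLike 𝕜] :
    ∃ U : EuclideanSpace 𝕜 (Fin 3) ≃ₗᵢ[𝕜] EuclideanSpace 𝕜 (Fin 3),
    ∃ b : EuclideanSpace 𝕜 (Fin 3), ∀ x, f.map 𝕜 x = (f.ratio : 𝕜) • U x + b := by
  have hrot : (f.rot : Matrix (Fin 3) (Fin 3) ℝ).map (algebraMap ℝ 𝕜) ∈
      unitary (Matrix (Fin 3) (Fin 3) 𝕜) := by
    have h := (Matrix.mem_orthogonalGroup_iff _ _).1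
      (Matrix.mem_specialOrthogonalGroup_iff.1 f.rot.2).1
    have hstar : star ((f.rot : Matrix (Fin 3) (Fin 3) ℝ).map (algebraMap ℝ 𝕜)) =
        (f.rot : Matrix (Fin 3) (Fin 3) ℝ).transpose.map (algebraMap ℝ 𝕜) := by
      ext i j
      simp [Matrix.star_apply]
    refine Matrix.mem_unitaryGroup_iff.2 ?_
    rw [hstar, ← Matrix.map_mul, h, Matrix.map_one _ (map_zero _) (map_one _)]
  have hu := Unitary.map_mem (Matrix.toEuclideanCLM (n := Fin 3) (𝕜 := 𝕜)) hrot
  refine ⟨Unitary.linearIsometryEquiv ⟨_, hu⟩, WithLp.toLp 2 fun i => (f.trans i : 𝕜), fun x => ?_⟩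
  ext i
  have happ : (Unitary.linearIsometryEquiv ⟨_, hu⟩ x) i =
      (((f.rot : Matrix (Fin 3) (Fin 3) ℝ).map (algebraMap ℝ 𝕜)).mulVec x.ofLp) i := rfl
  simp only [PiLp.add_apply, PiLp.smul_apply, happ]
  simp [Similarity.map, Matrix.mulVec, dotProduct]

/-- `1 - μ U` is injective because `μ U` scales norms by `‖μ‖ ≠ 1`, hence surjective in finite
dimension. -/
theorem LinearIsometryEquiv.exists_smul_add_eq_self {𝕜 V : Type*} [RCLike 𝕜]
    [NormedAddCommGroup V] [NormedSpace 𝕜 V] [FiniteDimensional 𝕜 V] (U : V ≃ₗᵢ[𝕜] V) {μ : 𝕜}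
    (hμ : ‖μ‖ ≠ 1) (b : V) : ∃ c, μ • U c + b = c := by
  let A : V →ₗ[𝕜] V := LinearMap.id - μ • (U.toLinearEquiv : V →ₗ[𝕜] V)
  have hA : ∀ v, A v = v - μ • U v := fun v => rfl
  have hinj : Function.Injective A := by
    rw [injective_iff_map_eq_zero]
    intro v hv
    rw [hA, sub_eq_zero] at hv
    have hnorm := congrArg norm hv
    rw [norm_smul, U.norm_map] at hnorm
    by_contra h0
    exact hμ (mul_right_cancel₀ (norm_ne_zero_iff.2 h0) (by rw [one_mul, ← hnorm]))
  obtain ⟨c, hc⟩ := LinearMap.injective_iff_surjective.1 hinj b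
  exact ⟨c, by rw [← hc, hA, add_sub_cancel]⟩

theorem mainTheorem2 {𝕜 : Type*} [RCLike 𝕜] (C : Set (EuclideanSpace 𝕜 (Fin 3)))
    (hC : IsAlgebraicSpaceCurve C) (hlines : ¬ IsUnionOfConcurrentLines C)
    (f : Similarity) (hf : f.map 𝕜 '' C = C) :
    Isometry (f.map ℝ) := by
  by_cases hratio : |f.ratio| = 1
  · obtain ⟨U, b, hU⟩ := f.exists_map_eq ℝ
    refine Isometry.of_dist_eq fun x y => ?_
    simp [hU, dist_smul₀, hratio]
  · refine absurd ?_ hlines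
    obtain ⟨U, b, hU⟩ := f.exists_map_eq 𝕜
    have hnorm : ‖(f.ratio : 𝕜)‖ = |f.ratio| := by simp
    have hne : (f.ratio : 𝕜) ≠ 0 := by simpa using f.ratio_ne_zero
    obtain ⟨c, hc⟩ := U.exists_smul_add_eq_self (hnorm.trans_ne hratio) b
    have hmap : ∀ x, f.map 𝕜 x = c + (f.ratio : 𝕜) • U (x - c) := by
      intro x
      rw [hU, map_sub, smul_sub, ← sub_eq_iff_eq_add'.2 hc.symm]
      abel
    obtain ⟨S, hS⟩ := hC.1
    refine isUnionOfConcurrentLines_of_add_smul_mem (hC.ne_singleton c) ?_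
    rcases lt_or_gt_of_ne hratio with hlt | hgt
    -- A contraction is replaced by its inverse, an expansion with the same centre that also
    -- preserves `C`.
    · refine fun x hx t => add_smul_mem_of_forall_mem hS U.symm (μ := (f.ratio : 𝕜)⁻¹) ?_ c ?_ hx t
      · rw [norm_inv, hnorm]
        exact (one_lt_inv₀ (abs_pos.2 f.ratio_ne_zero)).2 hlt
      · intro x hx
        rw [← hf] at hx
        obtain ⟨y, hy, rfl⟩ := hx
        rw [hmap, add_sub_cancel_left, map_smul, U.symm_apply_apply, inv_smul_smul₀ hne,
          add_sub_cancel]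
        exact hy
    · refine fun x hx t => add_smul_mem_of_forall_mem hS U (hgt.trans_eq hnorm.symm) c ?_ hx t
      intro x hx
      rw [← hmap, ← hf]
      exact Set.mem_image_of_mem _ hx
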